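/- Let $T^\infty$ be the triangular tiling graph: its vertices are the points $xp+yq$ with $x,y\in\mathbb Z$, $p=(1,0)$, $q=(1/2,\sqrt3/2)$, and two vertices are adjacent iff their Euclidean distance is $1$. Its triangular faces are called cells. A triangular grid graph is a subgraph $G$ of $T^\infty$ formed by all edges bounding finitely many cells, with the endpoints of these edges as vertices. A cell belongs to $G$ if all three of its edges are edges of $G$. An edge of $G$ is a boundary edge if it is also an edge of a cell of $T^\infty$ that does not belong to $G$. A cell belonging to $G$ is a boundary cell if at least one of its edges is a boundary edge, and an interior cell otherwise. For a set $S$ of cells belonging to $G$, the subdivision of $S$ in $G$ is the graph $G_S$ obtained from $G$ by adding, for each cell in $S$, one new vertex adjacent to exactly the three vertices of that cell. A graph with vertex set $V$ is word-representable if there is a finite word $w$ over $V$, containing every vertex at least once, such that any two distinct $x,y\in V$ are adjacent iff they alternate in $w$, i.e. deleting all other letters from $w$ leaves $xyxy\cdots$ or $yxyx\cdots$. Let $A''$ be the graph on $\{1,\dots,7\}$ with edges $23,34,24$ (a triangle), $25,35$, $36,46$, $27,47$ and $12,13,14$; it is the triangular grid graph formed by a cell and its three neighbouring cells, with the central cell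 subdivided. **Theorem.** Let $G$ be a triangular grid graph and let $S$ be a set of cells belonging to $G$. Then the subdivision $G_S$ is word-representable if and only if it has no induced subgraph isomorphic to $A''$; and $G_S$ is word-representable if and only if no cell in $S$ is an interior cell of $G$. -/

import Mathlib

/-- The Euclidean position `x p + y q` of the grid point `(x, y)`, where `p = (1, 0)` and
`q = (1/2, √3/2)`. -/
noncomputable def gridPoint (v : ℤ × ℤ) : EuclideanSpace ℝ (Fin 2) :=
  !₂[(v.1 : ℝ) + (v.2 : ℝ) / 2, (v.2 : ℝ) * (Real.sqrt 3 / 2)]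

/-- The triangular tiling graph: two grid points are adjacent iff their Euclidean distance is `1`. -/
noncomputable def triangularTiling : SimpleGraph (ℤ × ℤ) where
  Adj u v := dist (gridPoint u) (gridPoint v) = 1
  symm := ⟨fun u v h => by rw [dist_comm]; exact h⟩
  loopless := ⟨fun u h => by simp at h⟩

/-- Adjacency in the tiling in terms of the integer coordinates. -/
theorem triangularTiling_adj (u v : ℤ × ℤ) :
    triangularTiling.Adj u v ↔
      (u.1 - v.1) ^ 2 + (u.1 - v.1) * (u.2 - v.2) + (u.2 - v.2) ^ 2 = 1 := by
  have h3 : Real.sqrt 3 ^ 2 = 3 := Real.sq_sqrt (by norm_num)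
  have key : ((u.1 : ℝ) + (u.2 : ℝ) / 2 - ((v.1 : ℝ) + (v.2 : ℝ) / 2)) ^ 2 +
      ((u.2 : ℝ) * (Real.sqrt 3 / 2) - (v.2 : ℝ) * (Real.sqrt 3 / 2)) ^ 2 =
      ((u.1 : ℝ) - v.1) ^ 2 + ((u.1 : ℝ) - v.1) * ((u.2 : ℝ) - v.2) + ((u.2 : ℝ) - v.2) ^ 2 := by
    linear_combination ((u.2 : ℝ) - v.2) ^ 2 / 4 * h3
  change dist (gridPoint u) (gridPoint v) = 1 ↔ _
  rw [EuclideanSpace.dist_eq, Real.sqrt_eq_one]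
  simp only [Fin.sum_univ_two, Real.dist_eq, sq_abs, gridPoint, PiLp.toLp_apply,
    Matrix.cons_val_zero, Matrix.cons_val_one]
  rw [key]
  norm_cast

/-- The cells, i.e. the triangular faces of the tiling: with each grid point `(x, y)` come an
upward triangle and a downward triangle. -/
inductive Cell : Type
  | up (x y : ℤ) : Cell
  | down (x y : ℤ) : Cell

/-- The three vertices of a cell. -/
def Cell.verts : Cell → Finset (ℤ × ℤ)
  | .up x y => {(x, y), (x + 1, y), (x, y + 1)}
  | .down x y => {(x + 1, y), (x, y + 1), (x + 1, y + 1)}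

/-- Any two distinct vertices of a cell are adjacent in the tiling. -/
theorem Cell.adj_of_mem (c : Cell) {u v : ℤ × ℤ} (hu : u ∈ c.verts) (hv : v ∈ c.verts)
    (huv : u ≠ v) : triangularTiling.Adj u v := by
  rw [triangularTiling_adj]
  cases c <;> simp only [Cell.verts, Finset.mem_insert, Finset.mem_singleton] at hu hv <;>
    rcases hu with rfl | rfl | rfl <;> rcases hv with rfl | rfl | rfl <;>
    first
      | exact absurd rfl huv
      | (dsimp only; ring)

/-- The subgraph of the tiling formed by all edges bounding the cells in `C`; its vertices are the
endpoints of these edges. -/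
def gridGraphOf (C : Finset Cell) : triangularTiling.Subgraph where
  verts := {v | ∃ c ∈ C, v ∈ c.verts}
  Adj u v := u ≠ v ∧ ∃ c ∈ C, u ∈ c.verts ∧ v ∈ c.verts
  adj_sub := fun ⟨huv, c, _, hu, hv⟩ => c.adj_of_mem hu hv huv
  edge_vert := fun ⟨_, c, hc, hu, _⟩ => ⟨c, hc, hu⟩
  symm := ⟨fun _ _ ⟨huv, c, hc, hu, hv⟩ => ⟨huv.symm, c, hc, hv, hu⟩⟩

/-- A triangular grid graph: a subgraph of the tiling formed by all edges bounding finitely many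
cells. -/
def IsTriangularGridGraph (G : triangularTiling.Subgraph) : Prop :=
  ∃ C : Finset Cell, G = gridGraphOf C

/-- A cell belongs to `G` iff all of its edges belong to `G`. -/
def CellBelongs (G : triangularTiling.Subgraph) (c : Cell) : Prop :=
  ∀ u ∈ c.verts, ∀ v ∈ c.verts, u ≠ v → G.Adj u v

/-- `uv` is a boundary edge of `G`: an edge of `G` shared with a cell not belonging to `G`. -/
def IsBoundaryEdge (G : triangularTiling.Subgraph) (u v : ℤ × ℤ) : Prop :=
  G.Adj u v ∧ ∃ c : Cell, ¬ CellBelongs G c ∧ u ∈ c.verts ∧ v ∈ c.verts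

/-- A boundary cell of `G`: a cell belonging to `G` one of whose edges is a boundary edge. -/
def IsBoundaryCell (G : triangularTiling.Subgraph) (c : Cell) : Prop :=
  CellBelongs G c ∧ ∃ u ∈ c.verts, ∃ v ∈ c.verts, IsBoundaryEdge G u v

/-- An interior cell of `G`: a cell belonging to `G` that is not a boundary cell. -/
def IsInteriorCell (G : triangularTiling.Subgraph) (c : Cell) : Prop :=
  CellBelongs G c ∧ ¬ IsBoundaryCell G c

/-- The adjacency relation of the subdivision: the edges of `G` are kept, and the new vertex of
each subdivided cell is joined exactly to the three vertices of that cell. -/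
def subdivisionAdj (G : triangularTiling.Subgraph) (S : Set Cell) : G.verts ⊕ S → G.verts ⊕ S → Prop
  | .inl u, .inl v => G.Adj u v
  | .inl u, .inr c => (u : ℤ × ℤ) ∈ (c : Cell).verts
  | .inr c, .inl v => (v : ℤ × ℤ) ∈ (c : Cell).verts
  | .inr _, .inr _ => False

/-- The subdivision of the set `S` of cells of `G`: one new vertex is placed in each cell in `S`
and made adjacent to the three vertices of the cell. -/
def subdivision (G : triangularTiling.Subgraph) (S : Set Cell) : SimpleGraph (G.verts ⊕ S) where
  Adj := subdivisionAdj G S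
  symm := ⟨by
    rintro (u | c) (v | d) h
    · exact G.symm.symm _ _ h
    · exact h
    · exact h
    · exact h⟩
  loopless := ⟨by
    rintro (u | c) h
    · exact G.loopless.irrefl _ h
    · exact h⟩

/-- The graph `A''`: vertices `2, 3, 4` form a triangle, `5, 6, 0` are joined to the pairs
`{2, 3}`, `{3, 4}`, `{2, 4}` respectively, and `1` is joined to `2, 3, 4`. -/
def graphADoublePrime : SimpleGraph (Fin 7) :=
  SimpleGraph.fromEdgeSet
    {s(2, 3), s(3, 4), s(2, 4), s(5, 2), s(5, 3), s(6, 3), s(6, 4), s(0, 2), s(0, 4),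
      s(1, 2), s(1, 3), s(1, 4)}

open Classical in
/-- The letters `x` and `y` alternate in the word `w`: after deleting all other letters, no two
consecutive letters are equal (so what remains is `xyxy⋯` or `yxyx⋯`). -/
def Alternate {V : Type*} (w : List V) (x y : V) : Prop :=
  (w.filter fun z => z = x ∨ z = y).IsChain (· ≠ ·)

/-- A graph is word-representable if there is a (finite) word over its vertex set, in which every
vertex occurs, such that distinct `x` and `y` alternate in the word iff they are adjacent. -/
def WordRepresentable {V : Type*} (G : SimpleGraph V) : Prop :=
  ∃ w : List V, (∀ x, x ∈ w) ∧ ∀ x y, x ≠ y → (Alternate w x y ↔ G.Adj x y)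

/-!
A cell `c` of `S` that is interior has three neighbouring cells belonging to `G`, and together with
the new vertex of `c` they form an induced `A''` (`isIndContained_of_isInteriorCell`).

A word-representable graph has no induced `A''`
(`WordRepresentable.not_isIndContained_graphADoublePrime`). Indeed the pairwise adjacent vertices
`1`, `2`, `3`, `4` would recur in a fixed cyclic order, in which two of `2`, `3`, `4` are opposite.
The further common neighbour of these two stays in one of the two gaps between them; the one of the
other two vertices lying in the other gap then alternates with it, although they are not adjacent.
Alternation is handled through the numbers of occurrences in prefixes of the word
(`alternate_iff_leadsIn`), so that the argument becomes linear arithmetic.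

Conversely, let all cells of `S` be boundary cells. A graph with a semi-transitive orientation is
word-representable (`wordRepresentable_of_semitransitive`): for every vertex `v` there is a word in
which each letter occurs twice, all arcs alternate, tail first, and `v` alternates with its
neighbours only; the concatenation of these words represents the graph. To orient the subdivision,
colour the grid points properly by the levels `1`, `3`, `5`, and give the new vertex of a cell the
level `0`, `2` or `4` if a boundary edge of this cell joins the levels `1` and `5`, `1` and `3`, or
`3` and `5`. Edges are directed upwards. A directed path bypassed by an arc could violate
semi-transitivity only through a cell of `G` on the other side of a boundary edge, which does not
exist (`semitransitive_of_levels`, `wordRepresentable_subdivision`).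
-/

/-! ### Alternation and prefix counts -/

open Classical in
/-- In every prefix of `w` the letter `x` occurs as often as `y`, or once more: the letters `x`
and `y` alternate in `w`, and `x` comes first. -/
def LeadsIn {V : Type*} (w : List V) (x y : V) : Prop :=
  ∀ l, l <+: w → l.count y ≤ l.count x ∧ l.count x ≤ l.count y + 1

theorem leadsIn_cons_self {V : Type*} {w : List V} {x y : V} (h : x ≠ y) :
    LeadsIn (x :: w) x y ↔ LeadsIn w y x := by
  classical
  constructor
  · intro H l hl
    have := H (x :: l) (by simpa using hl)
    simp only [List.count_cons_self, List.count_cons_of_ne h] at this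
    omega
  · intro H l hl
    rcases List.prefix_cons_iff.1 hl with rfl | ⟨t, rfl, ht⟩
    · simp
    · have := H t ht
      simp only [List.count_cons_self, List.count_cons_of_ne h]
      omega

theorem not_leadsIn_cons {V : Type*} {w : List V} {x y : V} (h : x ≠ y) :
    ¬ LeadsIn (y :: w) x y := by
  classical
  intro H
  have := H [y] (by simp)
  simp [List.count_cons_of_ne h.symm] at this

theorem leadsIn_cons_of_ne {V : Type*} {w : List V} {x y z : V} (hx : z ≠ x) (hy : z ≠ y) :
    LeadsIn (z :: w) x y ↔ LeadsIn w x y := by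
  classical
  constructor
  · intro H l hl
    have := H (z :: l) (by simpa using hl)
    simpa only [List.count_cons_of_ne hx, List.count_cons_of_ne hy] using this
  · intro H l hl
    rcases List.prefix_cons_iff.1 hl with rfl | ⟨t, rfl, ht⟩
    · simp
    · simpa only [List.count_cons_of_ne hx, List.count_cons_of_ne hy] using H t ht

open Classical in
theorem leadsIn_iff_isChain {V : Type*} (w : List V) :
    ∀ x y : V, x ≠ y →
      (LeadsIn w x y ↔ (y :: w.filter fun z => z = x ∨ z = y).IsChain (· ≠ ·)) := by
  induction w with
  | nil =>
    intro x y _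
    simp [LeadsIn]
  | cons z w ih =>
    intro x y hxy
    by_cases hx : z = x
    · subst hx
      have hc : (w.filter fun t => t = z ∨ t = y) = w.filter fun t => t = y ∨ t = z :=
        List.filter_congr fun t _ => by simp only [or_comm]
      rw [leadsIn_cons_self hxy, ih y z hxy.symm, List.filter_cons_of_pos (by simp),
        List.isChain_cons_cons, hc]
      exact ⟨fun h => ⟨hxy.symm, h⟩, fun h => h.2⟩
    · by_cases hy : z = y
      · subst hy
        rw [List.filter_cons_of_pos (by simp), List.isChain_cons_cons]
        exact iff_of_false (not_leadsIn_cons hxy) (fun h => h.1 rfl)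
      · rw [leadsIn_cons_of_ne hx hy, ih x y hxy, List.filter_cons_of_neg (by simp [hx, hy])]

/-- Two letters alternate iff one of them leads the other. -/
theorem alternate_iff_leadsIn {V : Type*} {w : List V} {x y : V} (hxy : x ≠ y) :
    Alternate w x y ↔ LeadsIn w x y ∨ LeadsIn w y x := by
  classical
  have hc : (w.filter fun t => t = y ∨ t = x) = w.filter fun t => t = x ∨ t = y :=
    List.filter_congr fun t _ => by simp only [or_comm]
  rw [leadsIn_iff_isChain w x y hxy, leadsIn_iff_isChain w y x hxy.symm, hc, Alternate]
  have hmem : ∀ z ∈ w.filter (fun t => t = x ∨ t = y), z = x ∨ z = y := by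
    intro z hz
    simpa using (List.mem_filter.1 hz).2
  generalize w.filter (fun t => t = x ∨ t = y) = l at hmem
  cases l with
  | nil => simp
  | cons z l =>
    simp only [List.isChain_cons_cons]
    rcases hmem z (by simp) with rfl | rfl
    · exact ⟨fun h => Or.inl ⟨hxy.symm, h⟩, fun h => h.elim And.right And.right⟩
    · exact ⟨fun h => Or.inr ⟨hxy, h⟩, fun h => h.elim And.right And.right⟩

/-! ### Four pairwise alternating letters -/

/-- If `p`, `q`, `s`, `t` alternate pairwise and appear in this cyclic order, then a letter
alternating with the opposite letters `p` and `s` alternates with `q` or with `t`: it lies either in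
the gap from `p` to `s`, hence alternates with `t`, or in the gap from `s` to `p`, hence alternates
with `q`. -/
theorem leadsIn_opposite_of_first {V : Type*} {w : List V} {p q s t z : V}
    (hpq : LeadsIn w p q) (hqs : LeadsIn w q s) (hst : LeadsIn w s t) (hpt : LeadsIn w p t)
    (hp : LeadsIn w z p ∨ LeadsIn w p z) (hs : LeadsIn w z s ∨ LeadsIn w s z) :
    (LeadsIn w z q ∨ LeadsIn w q z) ∨ (LeadsIn w z t ∨ LeadsIn w t z) := by
  rcases hp with hp | hp <;> rcases hs with hs | hs
  · refine Or.inl (Or.inl fun l hl => ?_)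
    have := hpq l hl; have := hqs l hl; have := hp l hl; have := hs l hl
    omega
  · refine Or.inl (Or.inl fun l hl => ?_)
    have := hpq l hl; have := hqs l hl; have := hp l hl; have := hs l hl
    omega
  · refine Or.inr (Or.inl fun l hl => ?_)
    have := hst l hl; have := hpt l hl; have := hp l hl; have := hs l hl
    omega
  · refine Or.inl (Or.inr fun l hl => ?_)
    have := hpq l hl; have := hqs l hl; have := hp l hl; have := hs l hl
    omega

/-- The companion of `leadsIn_opposite_of_first` for the opposite letters `q` and `t`. -/
theorem leadsIn_opposite_of_second {V : Type*} {w : List V} {p q s t z : V}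
    (hpq : LeadsIn w p q) (hqs : LeadsIn w q s) (hst : LeadsIn w s t) (hpt : LeadsIn w p t)
    (hq : LeadsIn w z q ∨ LeadsIn w q z) (ht : LeadsIn w z t ∨ LeadsIn w t z) :
    (LeadsIn w z p ∨ LeadsIn w p z) ∨ (LeadsIn w z s ∨ LeadsIn w s z) := by
  rcases hq with hq | hq <;> rcases ht with ht | ht
  · refine Or.inr (Or.inl fun l hl => ?_)
    have := hqs l hl; have := hst l hl; have := hq l hl; have := ht l hl
    omega
  · refine Or.inr (Or.inl fun l hl => ?_)
    have := hqs l hl; have := hst l hl; have := hq l hl; have := ht l hl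
    omega
  · refine Or.inl (Or.inr fun l hl => ?_)
    have := hpq l hl; have := hpt l hl; have := hq l hl; have := ht l hl
    omega
  · refine Or.inr (Or.inr fun l hl => ?_)
    have := hqs l hl; have := hst l hl; have := hq l hl; have := ht l hl
    omega

theorem LeadsIn.trans_of_or {V : Type*} {w : List V} {x y z : V} (hxy : LeadsIn w x y)
    (hyz : LeadsIn w y z) (h : LeadsIn w x z ∨ LeadsIn w z x) : LeadsIn w x z := by
  rcases h with h | h
  · exact h
  · intro l hl
    have := hxy l hl; have := hyz l hl; have := h l hl
    omega

/-- Let `u` and `a`, `b`, `c` alternate pairwise. It is impossible that for each of the three pairs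
from `a`, `b`, `c` some letter alternates with that pair but neither with the third letter nor with
`u`: one of the pairs is opposite in the cyclic order of the four letters. The statement is for
letters sorted so that `a` leads `b` and `b` leads `c`. -/
theorem false_of_leadsIn_of_sorted {V : Type*} {w : List V} {u a b c : V}
    (hua : LeadsIn w u a ∨ LeadsIn w a u) (hub : LeadsIn w u b ∨ LeadsIn w b u)
    (huc : LeadsIn w u c ∨ LeadsIn w c u)
    (hab : LeadsIn w a b) (hbc : LeadsIn w b c) (hac : LeadsIn w a c)
    (h1 : ∃ z, (LeadsIn w z a ∨ LeadsIn w a z) ∧ (LeadsIn w z b ∨ LeadsIn w b z) ∧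
      ¬ ((LeadsIn w z c ∨ LeadsIn w c z) ∨ (LeadsIn w z u ∨ LeadsIn w u z)))
    (h2 : ∃ z, (LeadsIn w z b ∨ LeadsIn w b z) ∧ (LeadsIn w z c ∨ LeadsIn w c z) ∧
      ¬ ((LeadsIn w z a ∨ LeadsIn w a z) ∨ (LeadsIn w z u ∨ LeadsIn w u z)))
    (h3 : ∃ z, (LeadsIn w z a ∨ LeadsIn w a z) ∧ (LeadsIn w z c ∨ LeadsIn w c z) ∧
      ¬ ((LeadsIn w z b ∨ LeadsIn w b z) ∨ (LeadsIn w z u ∨ LeadsIn w u z))) : False := by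
  obtain ⟨z1, h1a, h1b, h1⟩ := h1
  obtain ⟨z2, h2b, h2c, h2⟩ := h2
  obtain ⟨z3, h3a, h3c, h3⟩ := h3
  rcases hub with hub | hub
  · rcases hua with hua | hua
    · exact h3 (leadsIn_opposite_of_second hua hab hbc (hub.trans_of_or hbc huc) h3a h3c).symm
    · exact h1 (leadsIn_opposite_of_first hua hub hbc hac h1a h1b).symm
  · have hau : LeadsIn w a u := hab.trans_of_or hub hua.symm
    rcases huc with huc | huc
    · exact h2 (leadsIn_opposite_of_second hab hub huc hac h2b h2c)
    · exact h3 (leadsIn_opposite_of_first hab hbc huc hau h3a h3c)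

theorem false_of_leadsIn {V : Type*} {w : List V} {u a b c : V}
    (hua : LeadsIn w u a ∨ LeadsIn w a u) (hub : LeadsIn w u b ∨ LeadsIn w b u)
    (huc : LeadsIn w u c ∨ LeadsIn w c u) (hab : LeadsIn w a b ∨ LeadsIn w b a)
    (hbc : LeadsIn w b c ∨ LeadsIn w c b) (hac : LeadsIn w a c ∨ LeadsIn w c a)
    (h1 : ∃ z, (LeadsIn w z a ∨ LeadsIn w a z) ∧ (LeadsIn w z b ∨ LeadsIn w b z) ∧
      ¬ ((LeadsIn w z c ∨ LeadsIn w c z) ∨ (LeadsIn w z u ∨ LeadsIn w u z)))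
    (h2 : ∃ z, (LeadsIn w z b ∨ LeadsIn w b z) ∧ (LeadsIn w z c ∨ LeadsIn w c z) ∧
      ¬ ((LeadsIn w z a ∨ LeadsIn w a z) ∨ (LeadsIn w z u ∨ LeadsIn w u z)))
    (h3 : ∃ z, (LeadsIn w z a ∨ LeadsIn w a z) ∧ (LeadsIn w z c ∨ LeadsIn w c z) ∧
      ¬ ((LeadsIn w z b ∨ LeadsIn w b z) ∨ (LeadsIn w z u ∨ LeadsIn w u z))) : False := by
  have swap : ∀ {x y t : V},
      (∃ z, (LeadsIn w z x ∨ LeadsIn w x z) ∧ (LeadsIn w z y ∨ LeadsIn w y z) ∧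
        ¬ ((LeadsIn w z t ∨ LeadsIn w t z) ∨ (LeadsIn w z u ∨ LeadsIn w u z))) →
      ∃ z, (LeadsIn w z y ∨ LeadsIn w y z) ∧ (LeadsIn w z x ∨ LeadsIn w x z) ∧
        ¬ ((LeadsIn w z t ∨ LeadsIn w t z) ∨ (LeadsIn w z u ∨ LeadsIn w u z)) :=
    fun ⟨z, hx, hy, h⟩ => ⟨z, hy, hx, h⟩
  rcases hab with ab | ba
  · rcases hbc with bc | cb
    · exact false_of_leadsIn_of_sorted hua hub huc ab bc (ab.trans_of_or bc hac) h1 h2 h3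
    · rcases hac with ac | ca
      · exact false_of_leadsIn_of_sorted hua huc hub ac cb ab h3 (swap h2) h1
      · exact false_of_leadsIn_of_sorted huc hua hub ca ab cb (swap h3) h1 (swap h2)
  · rcases hac with ac | ca
    · exact false_of_leadsIn_of_sorted hub hua huc ba ac (ba.trans_of_or ac hbc) (swap h1) h3 h2
    · rcases hbc with bc | cb
      · exact false_of_leadsIn_of_sorted hub huc hua bc ca ba h2 (swap h3) (swap h1)
      · exact false_of_leadsIn_of_sorted huc hub hua cb ba ca (swap h2) (swap h1) (swap h3)

theorem graphADoublePrime_adj (i j : Fin 7) : graphADoublePrime.Adj i j ↔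
    (i, j) ∈ ([(2, 3), (3, 4), (2, 4), (5, 2), (5, 3), (6, 3), (6, 4), (0, 2), (0, 4), (1, 2),
      (1, 3), (1, 4), (3, 2), (4, 3), (4, 2), (2, 5), (3, 5), (3, 6), (4, 6), (2, 0), (4, 0),
      (2, 1), (3, 1), (4, 1)] : List (Fin 7 × Fin 7)) := by
  simp only [graphADoublePrime, SimpleGraph.fromEdgeSet_adj, Set.mem_insert_iff,
    Set.mem_singleton_iff]
  revert i j
  decide

/-- A word-representable graph has no induced `A''`: there the vertices `1`, `2`, `3`, `4` alternate
pairwise, and each pair from `2`, `3`, `4` has a common neighbour adjacent neither to `1` nor to the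
third vertex. -/
theorem WordRepresentable.not_isIndContained_graphADoublePrime {V : Type*} {H : SimpleGraph V}
    (hH : WordRepresentable H) : ¬ graphADoublePrime.IsIndContained H := by
  rintro ⟨e⟩
  obtain ⟨w, -, hw⟩ := hH
  have key : ∀ i j : Fin 7, i ≠ j →
      ((LeadsIn w (e i) (e j) ∨ LeadsIn w (e j) (e i)) ↔ graphADoublePrime.Adj i j) := by
    intro i j hij
    have hne : e i ≠ e j := fun h => hij (e.injective h)
    rw [← alternate_iff_leadsIn hne, hw _ _ hne, e.map_adj_iff]
  simp only [graphADoublePrime_adj] at key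
  refine false_of_leadsIn (w := w) (u := e 1) (a := e 2) (b := e 3) (c := e 4) ?_ ?_ ?_ ?_ ?_ ?_
    ⟨e 5, ?_⟩ ⟨e 6, ?_⟩ ⟨e 0, ?_⟩
  all_goals
    simp (disch := decide) only [key]
    decide

/-! ### From semi-transitive orientations to words -/

theorem List.eq_pair_of_nodup_of_mem_iff {α : Type*} {l : List α} {a b : α} (hl : l.Nodup)
    (hab : a ≠ b) (h : ∀ x, x ∈ l ↔ x = a ∨ x = b) : l = [a, b] ∨ l = [b, a] := by
  have hp : l.Perm [a, b] :=
    (List.perm_ext_iff_of_nodup hl (by simpa using hab)).2 fun x => by simp [h]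
  match l, hp with
  | [x, y], hp =>
    have hx := (h x).1 (by simp)
    have hy := (h y).1 (by simp)
    have hxy : x ≠ y := by simpa using hl
    grind
  | [], hp => simp at hp
  | [_], hp => simpa using hp.length_eq
  | _ :: _ :: _ :: _, hp => simpa using hp.length_eq

/-- The vertices of a finite type can be listed in the order of their levels. -/
theorem exists_list_sorted_by_level {V : Type*} [Finite V] (lev : V → ℕ) :
    ∃ l : List V, l.Nodup ∧ (∀ x, x ∈ l) ∧ l.Pairwise fun a b => lev a ≤ lev b := by
  classical
  have := Fintype.ofFinite V
  refine ⟨(Finset.univ : Finset V).toList.mergeSort (fun a b => decide (lev a ≤ lev b)), ?_, ?_, ?_⟩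
  · exact (List.mergeSort_perm _ _).nodup_iff.2 (Finset.nodup_toList _)
  · intro x
    exact (List.mergeSort_perm _ _).mem_iff.2 (by simp)
  · have := List.pairwise_mergeSort (le := fun a b : V => decide (lev a ≤ lev b))
      (fun a b c => by simpa using le_trans) (fun a b => by simpa using le_total _ _)
      (Finset.univ : Finset V).toList
    simpa using this

open Classical in
/-- The position of `u` relative to the centre `v` in an orientation `r`: `3` is `v` itself, `1` and
`4` are its in- and out-neighbours, `0` and `5` the other vertices from which `v` is reachable or
which are reachable from `v`, and `2` the remaining vertices. -/
noncomputable def relPosition {V : Type*} (r : V → V → Prop) (v u : V) : ℕ :=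
  if u = v then 3 else if r u v then 1 else if r v u then 4
  else if Relation.TransGen r u v then 0 else if Relation.TransGen r v u then 5 else 2

/-- The word in which every vertex occurs twice, made of blocks of vertices with the same position
relative to `v`, each block in the order of `l`. The blocks of the positions `0`, `2` and `5` are
nested with, or separated from, those of `v`, so that only neighbours alternate with `v`, while the
ends of an arc always occur alternately, the tail first. -/
noncomputable def centredWord {V : Type*} (r : V → V → Prop) (l : List V) (v : V) : List V :=
  [0, 1, 2, 0, 3, 4, 1, 3, 5, 2, 4, 5].flatMap fun k => l.filter fun u => relPosition r v u = k

section centred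

variable {V : Type*} {r : V → V → Prop} {lev : V → ℕ} {l : List V}

theorem centredWord_filter (v : V) (P : V → Bool) :
    (centredWord r l v).filter P = [0, 1, 2, 0, 3, 4, 1, 3, 5, 2, 4, 5].flatMap
      fun k => (l.filter P).filter fun u => relPosition r v u = k := by
  simp only [centredWord, List.filter_flatMap]
  congr 1
  funext k
  rw [List.filter_filter, List.filter_filter]
  exact List.filter_congr fun u _ => Bool.and_comm _ _

theorem lev_lt_of_transGen (hlev : ∀ u v, r u v → lev u < lev v) {u v : V}
    (h : Relation.TransGen r u v) : lev u < lev v := by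
  induction h with
  | single h => exact hlev _ _ h
  | tail _ h ih => exact ih.trans (hlev _ _ h)

open Relation in
/-- The pairs of positions that the ends of an arc can have relative to a centre. This is where
semi-transitivity enters: an arc bypassing the centre `v` on a path through `v` has both ends
joined to `v`. -/
theorem relPosition_of_rel (hlev : ∀ u v, r u v → lev u < lev v)
    (hst : ∀ x v y, r x y → TransGen r x v → TransGen r v y → r x v ∧ r v y) (v : V) {u x : V}
    (hux : r u x) : (relPosition r v u, relPosition r v x) ∈
      ([(0, 0), (0, 1), (0, 2), (1, 1), (1, 2), (1, 3), (1, 4), (2, 2), (2, 4), (2, 5), (3, 4),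
        (4, 4), (4, 5), (5, 5)] : List (ℕ × ℕ)) := by
  have h0 : ∀ {a b}, r a b → TransGen r a b := fun h => TransGen.single h
  have irr : ∀ a, ¬ TransGen r a a := fun a h => (lev_lt_of_transGen hlev h).false
  have tr : ∀ {a b c}, TransGen r a b → TransGen r b c → TransGen r a c := fun h h' => h.trans h'
  have hux' := h0 hux
  have s1 := hst u v x hux
  have s2 := hst u x v
  have s3 := hst v u x
  unfold relPosition
  by_cases e1 : u = v
  · subst e1
    have : x ≠ u := by rintro rfl; exact irr _ hux'
    have : ¬ r x u := fun h => irr _ (tr hux' (h0 h))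
    simp [*]
  by_cases e2 : x = v
  · subst e2
    simp [*]
  simp only [e1, e2, if_false]
  split_ifs <;> first | decide | (exfalso; grind)

open Relation Classical in
/-- A finite graph with a semi-transitive orientation is word-representable. Here semi-transitivity
reads: if an arc joins the ends of a directed path, then arcs join these ends to every inner vertex
of the path. -/
theorem wordRepresentable_of_semitransitive [Finite V] (G : SimpleGraph V)
    (hG : ∀ u v, G.Adj u v ↔ r u v ∨ r v u) (hlev : ∀ u v, r u v → lev u < lev v)
    (hst : ∀ x v y, r x y → TransGen r x v → TransGen r v y → r x v ∧ r v y) :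
    WordRepresentable G := by
  obtain ⟨l, hnd, hmem, hsort⟩ := exists_list_sorted_by_level lev
  have hself : ∀ v, relPosition r v v = 3 := fun v => by simp [relPosition]
  have hpair : ∀ x y, x ≠ y → (l.filter fun z => z = x ∨ z = y) = [x, y] ∨
      (l.filter fun z => z = x ∨ z = y) = [y, x] := fun x y hxy =>
    List.eq_pair_of_nodup_of_mem_iff (hnd.filter _) hxy fun z => by simp [hmem]
  -- Every arc alternates in every centred word, its tail coming first.
  have harc : ∀ u x, r u x → ∀ v,
      ((centredWord r l v).filter fun z => z = u ∨ z = x) = [u, x, u, x] := by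
    intro u x hux v
    have hlt := hlev _ _ hux
    have hl : (l.filter fun z => z = u ∨ z = x) = [u, x] := by
      rcases hpair u x (fun h => by subst h; exact hlt.false) with h | h
      · exact h
      · have := hsort.filter fun z => z = u ∨ z = x
        rw [h] at this
        simp at this
        omega
    rw [centredWord_filter, hl]
    have := relPosition_of_rel hlev hst v hux
    simp only [List.mem_cons, Prod.mk.injEq, List.not_mem_nil, or_false] at this
    rcases this with h | h | h | h | h | h | h | h | h | h | h | h | h | h <;>
      simp [List.filter_cons, h.1, h.2]
  -- A vertex not adjacent to the centre does not alternate with it in the centred word.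
  have hnon : ∀ v u, u ≠ v → ¬ G.Adj u v →
      ¬ ((centredWord r l v).filter fun z => z = u ∨ z = v).IsChain (· ≠ ·) := by
    intro v u huv hadj
    rw [hG, not_or] at hadj
    have hpos : relPosition r v u = 0 ∨ relPosition r v u = 2 ∨ relPosition r v u = 5 := by
      unfold relPosition
      simp only [huv, hadj.1, hadj.2, if_false]
      split_ifs <;> simp
    rw [centredWord_filter]
    rcases hpair u v huv with h | h <;> rw [h] <;> rcases hpos with hp | hp | hp <;>
      simp [List.filter_cons, hp, hself]
  refine ⟨l.flatMap (centredWord r l), fun x => ?_, fun x y hxy => ?_⟩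
  · refine List.mem_flatMap.2 ⟨x, hmem x, ?_⟩
    rw [centredWord, List.mem_flatMap]
    exact ⟨3, by simp, by simp [hmem, hself]⟩
  · have hfil : ∀ m : List V, ((m.flatMap (centredWord r l)).filter fun z => z = x ∨ z = y) =
        m.flatMap fun v => (centredWord r l v).filter fun z => z = x ∨ z = y := fun m =>
      List.filter_flatMap
    constructor
    · intro h
      by_contra hadj
      obtain ⟨s, t, hl⟩ := List.append_of_mem (hmem y)
      have hinf : (centredWord r l y).filter (fun z => z = x ∨ z = y) <:+:
          (l.flatMap (centredWord r l)).filter fun z => z = x ∨ z = y := by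
        refine List.IsInfix.filter _ ⟨s.flatMap (centredWord r l), t.flatMap (centredWord r l), ?_⟩
        conv_rhs => arg 2; rw [hl]
        simp
      exact hnon y x hxy hadj (h.infix hinf)
    · intro hadj
      have hrep : ∀ a b : V, a ≠ b → ∀ m : List V,
          (m.flatMap fun _ => [a, b, a, b]).IsChain (· ≠ ·) := by
        intro a b hab m
        suffices h : (b :: m.flatMap fun _ => [a, b, a, b]).IsChain (· ≠ ·) from h.tail
        induction m with
        | nil => simp
        | cons _ m ih =>
          simp only [List.flatMap_cons, List.cons_append, List.nil_append, List.isChain_cons_cons]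
          exact ⟨hab.symm, hab, hab.symm, hab, ih⟩
      rw [Alternate, hfil]
      rcases (hG x y).1 hadj with h | h
      · simp only [harc x y h]
        exact hrep x y hxy l
      · have hc : ∀ v, ((centredWord r l v).filter fun z => z = x ∨ z = y) = [y, x, y, x] := by
          intro v
          rw [← harc y x h v]
          exact List.filter_congr fun t _ => by simp only [or_comm]
        simp only [hc]
        exact hrep y x hxy.symm l

end centred

/-! ### The orientation by levels -/

section levels

open Relation

variable {V : Type*} {A : V → V → Prop} {lev : V → ℕ}

/-- Suppose any two neighbours, of different levels, of a vertex of even level are adjacent. Then a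
path ascending through the levels `0` to `5` can bypass its inner vertices of even level, which
leaves at most two inner vertices. -/
theorem transGen_level_cases (hle : ∀ v, lev v ≤ 5)
    (htri : ∀ n p q, lev n % 2 = 0 → A p n → A n q → lev p ≠ lev q → A p q) {x y : V}
    (h : TransGen (fun u v => A u v ∧ lev u < lev v) x y) :
    lev x < lev y ∧ (A x y ∨ (∃ z, lev z % 2 = 1 ∧ lev x < lev z ∧ lev z < lev y ∧ A x z ∧ A z y) ∨
      ∃ z z', lev z = 1 ∧ lev z' = 3 ∧ lev x = 0 ∧ 3 < lev y ∧ A x z ∧ A z z' ∧ A z' y) := by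
  induction h using TransGen.head_induction_on with
  | single h => exact ⟨h.2, Or.inl h.1⟩
  | @head x w h _ ih =>
    obtain ⟨hxw, hlt⟩ := h
    obtain ⟨hwy, ih⟩ := ih
    have := hle y
    refine ⟨hlt.trans hwy, ?_⟩
    by_cases hw : lev w % 2 = 0
    · rcases ih with ih | ⟨z, hz, h1, h2, h3, h4⟩ | ⟨z, z', hz, hz', h0, -⟩
      · exact Or.inl (htri w x y hw hxw ih (by omega))
      · exact Or.inr (Or.inl ⟨z, hz, by omega, h2, htri w x z hw hxw h3 (by omega), h4⟩)
      · omega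
    · rcases ih with ih | ⟨z, hz, h1, h2, h3, h4⟩ | ⟨z, z', hz, hz', h0, -⟩
      · exact Or.inr (Or.inl ⟨w, by omega, hlt, hwy, hxw, ih⟩)
      · exact Or.inr (Or.inr ⟨w, z, by omega, by omega, by omega, by omega, hxw, h3, h4⟩)
      · omega

/-- The orientation towards higher levels is semi-transitive if vertices of even level are
independent with cliques as neighbourhoods, and the following holds for a vertex `n` of even level.
Let `p` and `q` be its neighbours of the levels `1` and `5` (for `n` of level `0`), or of the levels
just below and above that of `n` (for the levels `2` and `4`). Then the common neighbours of `p` and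
`q` lie in the closed neighbourhood of `n`. -/
theorem semitransitive_of_levels (hsymm : ∀ u v, A u v → A v u) (hle : ∀ v, lev v ≤ 5)
    (hnew : ∀ u v, A u v → lev u % 2 = 0 → lev v % 2 = 1)
    (htri : ∀ n p q, lev n % 2 = 0 → A p n → A n q → lev p ≠ lev q → A p q)
    (hbd : ∀ n p q t, (lev n = 0 ∧ lev p = 1 ∧ lev q = 5 ∨ lev n = 2 ∧ lev p = 1 ∧ lev q = 3 ∨
      lev n = 4 ∧ lev p = 3 ∧ lev q = 5) → A n p → A n q → A t p → A t q → t = n ∨ A t n)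
    {x v y : V} (hxy : A x y) (hlt : lev x < lev y)
    (hxv : TransGen (fun u v => A u v ∧ lev u < lev v) x v)
    (hvy : TransGen (fun u v => A u v ∧ lev u < lev v) v y) :
    (A x v ∧ lev x < lev v) ∧ (A v y ∧ lev v < lev y) := by
  obtain ⟨h1, hxv⟩ := transGen_level_cases hle htri hxv
  obtain ⟨h2, hvy⟩ := transGen_level_cases hle htri hvy
  have := hle y
  suffices h : A x v ∧ A v y from ⟨⟨h.1, h1⟩, h.2, h2⟩
  rcases hxv with hxv | ⟨z, hz, hz1, hz2, hxz, hzv⟩ | ⟨z, z', hz, hz', hx0, hv3, hxz, hzz, hzv⟩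
  · refine ⟨hxv, ?_⟩
    rcases hvy with hvy | ⟨z, hz, hz1, hz2, hvz, hzy⟩ | ⟨z, z', hz, hz', hv0, -⟩
    · exact hvy
    · have hv : lev v = 1 ∨ lev v = 2 := by omega
      rcases hv with hv | hv
      · exact htri x v y (by omega) (hsymm _ _ hxv) hxy (by omega)
      · have := hnew v x (hsymm _ _ hxv) (by omega)
        rcases hbd v x z y (by omega) (hsymm _ _ hxv) hvz (hsymm _ _ hxy) (hsymm _ _ hzy)
          with h | h
        · subst h; omega
        · exact hsymm _ _ h
    · omega
  · rcases hvy with hvy | ⟨z', hz', hz1', hz2', hvz, hzy⟩ | ⟨z', z'', hz', hz'', hv0, -⟩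
    · refine ⟨?_, hvy⟩
      have hz : lev z = 1 ∨ lev z = 3 := by omega
      rcases hz with hz | hz
      · have hy := hnew x y hxy (by omega)
        have hy : lev y = 3 ∨ lev y = 5 := by omega
        rcases hy with hy | hy
        · rcases hbd v z y x (by omega) (hsymm _ _ hzv) hvy hxz hxy with h | h
          · subst h; omega
          · exact h
        · rcases hbd x z y v (by omega) hxz hxy (hsymm _ _ hzv) hvy with h | h
          · subst h; omega
          · exact hsymm _ _ h
      · rcases hbd v z y x (by omega) (hsymm _ _ hzv) hvy hxz hxy with h | h
        · subst h; omega
        · exact h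
    · -- The path is `x, z, v, z', y` on the levels `0, 1, 2, 3, 5`; the conditions at `x` and then
      -- at `v` would make the even vertices `x` and `v` adjacent.
      exfalso
      have hy := hnew x y hxy (by omega)
      have hzz : A z z' := htri v z z' (by omega) hzv hvz (by omega)
      rcases hbd x z y z' (by omega) hxz hxy (hsymm _ _ hzz) hzy with h | h
      · subst h; omega
      · rcases hbd v z z' x (by omega) (hsymm _ _ hzv) hvz hxz (hsymm _ _ h) with h | h
        · subst h; omega
        · have := hnew x v h (by omega)
          omega
    · omega
  · -- The path is `x, z, z', v, y` on the levels `0, 1, 3, 4, 5`, and again the even vertices `x`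
    -- and `v` would be adjacent.
    exfalso
    rcases hvy with hvy | ⟨w, -, hw1, hw2, -⟩ | ⟨w, -, -, -, hv0, -⟩
    · have hzy : A z' y := htri v z' y (by omega) hzv hvy (by omega)
      rcases hbd x z y z' (by omega) hxz hxy (hsymm _ _ hzz) hzy with h | h
      · subst h; omega
      · rcases hbd v z' y x (by omega) (hsymm _ _ hzv) hvy (hsymm _ _ h) hxy with h | h
        · subst h; omega
        · have := hnew x v h (by omega)
          omega
    · omega
    · omega

end levels

/-! ### Cells of the triangular tiling -/

theorem adj_iff_six (u v : ℤ × ℤ) : triangularTiling.Adj u v ↔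
    v = (u.1 + 1, u.2) ∨ v = (u.1 - 1, u.2) ∨ v = (u.1, u.2 + 1) ∨ v = (u.1, u.2 - 1) ∨
      v = (u.1 + 1, u.2 - 1) ∨ v = (u.1 - 1, u.2 + 1) := by
  obtain ⟨a, b⟩ := u
  obtain ⟨c, d⟩ := v
  rw [triangularTiling_adj]
  simp only [Prod.mk.injEq]
  constructor
  · intro h
    obtain ⟨m, hm⟩ : ∃ m, m = a - c := ⟨_, rfl⟩
    obtain ⟨n, hn⟩ : ∃ n, n = b - d := ⟨_, rfl⟩
    rw [← hm, ← hn] at h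
    have h1 : m ≤ 1 := by nlinarith [sq_nonneg (m + 2 * n)]
    have h2 : -1 ≤ m := by nlinarith [sq_nonneg (m + 2 * n)]
    have h3 : n ≤ 1 := by nlinarith [sq_nonneg (n + 2 * m)]
    have h4 : -1 ≤ n := by nlinarith [sq_nonneg (n + 2 * m)]
    interval_cases m <;> interval_cases n <;> omega
  · rintro (⟨rfl, rfl⟩ | ⟨rfl, rfl⟩ | ⟨rfl, rfl⟩ | ⟨rfl, rfl⟩ | ⟨rfl, rfl⟩ | ⟨rfl, rfl⟩) <;> ring

/-- Three pairwise adjacent points are the vertices of a cell. -/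
theorem exists_cell_of_adj {u v w : ℤ × ℤ} (huv : triangularTiling.Adj u v)
    (huw : triangularTiling.Adj u w) (hvw : triangularTiling.Adj v w) :
    ∃ c : Cell, c.verts = {u, v, w} := by
  rw [adj_iff_six] at huv huw hvw
  obtain ⟨a, b⟩ := u
  rcases huv with rfl | rfl | rfl | rfl | rfl | rfl <;>
    rcases huw with rfl | rfl | rfl | rfl | rfl | rfl <;>
    simp only [Prod.mk.injEq] at hvw <;>
    first
      | (exfalso; omega)
      | (refine ⟨(.up a b), ?_⟩
         ext ⟨s, t⟩
         simp only [Cell.verts, Finset.mem_insert, Finset.mem_singleton, Prod.mk.injEq]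
         first | done | omega)
      | (refine ⟨(.up (a - 1) b), ?_⟩
         ext ⟨s, t⟩
         simp only [Cell.verts, Finset.mem_insert, Finset.mem_singleton, Prod.mk.injEq]
         first | done | omega)
      | (refine ⟨(.up a (b - 1)), ?_⟩
         ext ⟨s, t⟩
         simp only [Cell.verts, Finset.mem_insert, Finset.mem_singleton, Prod.mk.injEq]
         first | done | omega)
      | (refine ⟨(.down (a - 1) b), ?_⟩
         ext ⟨s, t⟩
         simp only [Cell.verts, Finset.mem_insert, Finset.mem_singleton, Prod.mk.injEq]
         first | done | omega)
      | (refine ⟨(.down a (b - 1)), ?_⟩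
         ext ⟨s, t⟩
         simp only [Cell.verts, Finset.mem_insert, Finset.mem_singleton, Prod.mk.injEq]
         first | done | omega)
      | (refine ⟨(.down (a - 1) (b - 1)), ?_⟩
         ext ⟨s, t⟩
         simp only [Cell.verts, Finset.mem_insert, Finset.mem_singleton, Prod.mk.injEq]
         first | done | omega)

/-- At most two cells share an edge. -/
theorem Cell.eq_of_common_edge {c c' d : Cell} {p q : ℤ × ℤ} (hpq : p ≠ q)
    (hp : p ∈ c.verts) (hq : q ∈ c.verts) (hp' : p ∈ c'.verts) (hq' : q ∈ c'.verts)
    (hpd : p ∈ d.verts) (hqd : q ∈ d.verts) (hcd : c ≠ d) (hcd' : c' ≠ d) : c = c' := by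
  obtain ⟨p1, p2⟩ := p
  obtain ⟨q1, q2⟩ := q
  -- The lower left corner of an upward cell is the coordinatewise minimum of any two of its
  -- vertices; dually for downward cells.
  have hmin : ∀ {x y}, (p1, p2) ∈ (Cell.up x y).verts → (q1, q2) ∈ (Cell.up x y).verts →
      x = min p1 q1 ∧ y = min p2 q2 := by
    intro x y h1 h2
    simp only [Cell.verts, Finset.mem_insert, Finset.mem_singleton, Prod.mk.injEq, ne_eq]
      at hpq h1 h2
    rcases h1 with ⟨rfl, rfl⟩ | ⟨rfl, rfl⟩ | ⟨rfl, rfl⟩ <;> rcases h2 with h2 | h2 | h2 <;> omega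
  have hmax : ∀ {x y}, (p1, p2) ∈ (Cell.down x y).verts → (q1, q2) ∈ (Cell.down x y).verts →
      x + 1 = max p1 q1 ∧ y + 1 = max p2 q2 := by
    intro x y h1 h2
    simp only [Cell.verts, Finset.mem_insert, Finset.mem_singleton, Prod.mk.injEq, ne_eq]
      at hpq h1 h2
    rcases h1 with ⟨rfl, rfl⟩ | ⟨rfl, rfl⟩ | ⟨rfl, rfl⟩ <;> rcases h2 with h2 | h2 | h2 <;> omega
  have hup : ∀ x y x' y', (p1, p2) ∈ (Cell.up x y).verts → (q1, q2) ∈ (Cell.up x y).verts →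
      (p1, p2) ∈ (Cell.up x' y').verts → (q1, q2) ∈ (Cell.up x' y').verts →
      Cell.up x y = Cell.up x' y' := by
    intro x y x' y' h1 h2 h3 h4
    rw [(hmin h1 h2).1, (hmin h1 h2).2, (hmin h3 h4).1, (hmin h3 h4).2]
  have hdown : ∀ x y x' y', (p1, p2) ∈ (Cell.down x y).verts → (q1, q2) ∈ (Cell.down x y).verts →
      (p1, p2) ∈ (Cell.down x' y').verts → (q1, q2) ∈ (Cell.down x' y').verts →
      Cell.down x y = Cell.down x' y' := by
    intro x y x' y' h1 h2 h3 h4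
    have h12 := hmax h1 h2
    have h34 := hmax h3 h4
    rw [show x = x' by omega, show y = y' by omega]
  rcases c with ⟨x, y⟩ | ⟨x, y⟩ <;> rcases c' with ⟨x', y'⟩ | ⟨x', y'⟩
  · exact hup _ _ _ _ hp hq hp' hq'
  · rcases d with ⟨s, t⟩ | ⟨s, t⟩
    · exact absurd (hup _ _ _ _ hp hq hpd hqd) hcd
    · exact absurd (hdown _ _ _ _ hp' hq' hpd hqd) hcd'
  · rcases d with ⟨s, t⟩ | ⟨s, t⟩
    · exact absurd (hup _ _ _ _ hp' hq' hpd hqd) hcd'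
    · exact absurd (hdown _ _ _ _ hp hq hpd hqd) hcd
  · exact hdown _ _ _ _ hp hq hp' hq'

/-- The level of a grid point: `1`, `3` or `5`, according to its colour in the proper 3-colouring
of the tiling by `x - y` modulo `3`. -/
def gridLevel (v : ℤ × ℤ) : ℕ := 2 * ((v.1 - v.2) % 3).toNat + 1

theorem gridLevel_cases (v : ℤ × ℤ) : gridLevel v = 1 ∨ gridLevel v = 3 ∨ gridLevel v = 5 := by
  unfold gridLevel
  omega

theorem gridLevel_ne {u v : ℤ × ℤ} (h : triangularTiling.Adj u v) : gridLevel u ≠ gridLevel v := by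
  rw [adj_iff_six] at h
  unfold gridLevel
  rcases h with rfl | rfl | rfl | rfl | rfl | rfl <;> dsimp only <;> omega

theorem Cell.eq_of_gridLevel_eq {c : Cell} {u v : ℤ × ℤ} (hu : u ∈ c.verts) (hv : v ∈ c.verts)
    (h : gridLevel u = gridLevel v) : u = v := by
  by_contra huv
  exact gridLevel_ne (c.adj_of_mem hu hv huv) h

/-! ### Subdivisions with boundary cells only -/

section subdivision

variable {G : triangularTiling.Subgraph} {S : Set Cell}

theorem gridGraph_finite (hG : IsTriangularGridGraph G) : G.verts.Finite := by
  obtain ⟨C, rfl⟩ := hG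
  have : (gridGraphOf C).verts = ⋃ c ∈ C, (c.verts : Set (ℤ × ℤ)) := by
    ext v
    simp [gridGraphOf]
  rw [this]
  exact C.finite_toSet.biUnion fun c _ => c.verts.finite_toSet

theorem CellBelongs.mem_verts {c : Cell} (hc : CellBelongs G c) {u : ℤ × ℤ} (hu : u ∈ c.verts) :
    u ∈ G.verts := by
  have hcard : 1 < c.verts.card := by cases c <;> simp [Cell.verts]
  obtain ⟨v, hv, hvu⟩ := Finset.exists_mem_ne hcard u
  exact (hc u hu v hv hvu.symm).fst_mem

theorem finite_of_cellBelongs (hG : IsTriangularGridGraph G) (hS : ∀ c ∈ S, CellBelongs G c) :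
    S.Finite := by
  have hfin := gridGraph_finite hG
  refine ((hfin.image fun p => Cell.up (p.1 - 1) p.2).union
    (hfin.image fun p => Cell.down (p.1 - 1) p.2)).subset fun c hc => ?_
  cases c with
  | up x y => exact Or.inl ⟨(x + 1, y), (hS _ hc).mem_verts (by simp [Cell.verts]), by simp⟩
  | down x y => exact Or.inr ⟨(x + 1, y), (hS _ hc).mem_verts (by simp [Cell.verts]), by simp⟩

/-- If a common neighbour of the ends of a boundary edge of a cell belonging to `G` is joined to
them in `G`, then it is the third vertex of that cell. -/
theorem IsBoundaryEdge.mem_of_adj {c : Cell} (hc : CellBelongs G c) {p q t : ℤ × ℤ}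
    (hpq : IsBoundaryEdge G p q) (hp : p ∈ c.verts) (hq : q ∈ c.verts) (htp : G.Adj t p)
    (htq : G.Adj t q) : t ∈ c.verts := by
  obtain ⟨hadj, d, hd, hpd, hqd⟩ := hpq
  obtain ⟨e, he⟩ := exists_cell_of_adj htp.adj_sub htq.adj_sub hadj.adj_sub
  have hbel : CellBelongs G e := by
    intro u hu v hv huv
    simp only [he, Finset.mem_insert, Finset.mem_singleton] at hu hv
    rcases hu with rfl | rfl | rfl <;> rcases hv with rfl | rfl | rfl <;>
      first
        | exact absurd rfl huv
        | assumption
        | (apply G.symm.symm; assumption)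
  have : c = e := Cell.eq_of_common_edge hadj.ne hp hq (by simp [he]) (by simp [he]) hpd hqd
    (by rintro rfl; exact hd hc) (by rintro rfl; exact hd hbel)
  simp [this, he]

/-- A boundary cell has a boundary edge, whose ends occupy two of the three grid levels; this fixes
a level for the new vertex: below all three for the ends `1` and `5`, and between the two ends
otherwise. -/
theorem exists_newLevel (h : ∀ c ∈ S, IsBoundaryCell G c) : ∃ f : S → ℕ, ∀ n : S,
    ∃ p ∈ (n : Cell).verts, ∃ q ∈ (n : Cell).verts, IsBoundaryEdge G p q ∧
      (f n = 0 ∧ gridLevel p = 1 ∧ gridLevel q = 5 ∨ f n = 2 ∧ gridLevel p = 1 ∧ gridLevel q = 3 ∨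
        f n = 4 ∧ gridLevel p = 3 ∧ gridLevel q = 5) := by
  have key : ∀ n : S, ∃ k : ℕ, ∃ p ∈ (n : Cell).verts, ∃ q ∈ (n : Cell).verts,
      IsBoundaryEdge G p q ∧
      (k = 0 ∧ gridLevel p = 1 ∧ gridLevel q = 5 ∨ k = 2 ∧ gridLevel p = 1 ∧ gridLevel q = 3 ∨
        k = 4 ∧ gridLevel p = 3 ∧ gridLevel q = 5) := by
    intro n
    obtain ⟨-, u, hu, v, hv, huv⟩ := h n n.2
    obtain ⟨p, hp, q, hq, hpq, hlt⟩ : ∃ p ∈ (n : Cell).verts, ∃ q ∈ (n : Cell).verts,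
        IsBoundaryEdge G p q ∧ gridLevel p < gridLevel q := by
      rcases (gridLevel_ne huv.1.adj_sub).lt_or_gt with hlt | hlt
      · exact ⟨u, hu, v, hv, huv, hlt⟩
      · obtain ⟨d, hd, hud, hvd⟩ := huv.2
        exact ⟨v, hv, u, hu, ⟨G.symm.symm _ _ huv.1, d, hd, hvd, hud⟩, hlt⟩
    have := gridLevel_cases p
    have := gridLevel_cases q
    have hk : gridLevel p = 1 ∧ gridLevel q = 5 ∨ gridLevel p = 1 ∧ gridLevel q = 3 ∨
        gridLevel p = 3 ∧ gridLevel q = 5 := by omega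
    rcases hk with hk | hk | hk
    · exact ⟨0, p, hp, q, hq, hpq, by omega⟩
    · exact ⟨2, p, hp, q, hq, hpq, by omega⟩
    · exact ⟨4, p, hp, q, hq, hpq, by omega⟩
  choose f hf using key
  exact ⟨f, hf⟩

/-- Subdividing boundary cells only preserves word-representability: orient the edges towards higher
levels. Across a boundary edge of a subdivided cell there is no further cell of `G`, so a common
neighbour of the ends of this edge is the new vertex or the third vertex of the cell. -/
theorem wordRepresentable_subdivision (hG : IsTriangularGridGraph G)
    (h : ∀ c ∈ S, IsBoundaryCell G c) : WordRepresentable (subdivision G S) := by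
  have hS : ∀ c ∈ S, CellBelongs G c := fun c hc => (h c hc).1
  have : Finite G.verts := (gridGraph_finite hG).to_subtype
  have : Finite S := (finite_of_cellBelongs hG hS).to_subtype
  obtain ⟨f, hf⟩ := exists_newLevel h
  let H := subdivision G S
  let lev : G.verts ⊕ S → ℕ := Sum.elim (fun u => gridLevel u) f
  have hgrid : ∀ u : G.verts, lev (.inl u) = 1 ∨ lev (.inl u) = 3 ∨ lev (.inl u) = 5 :=
    fun u => gridLevel_cases u
  have hnewlev : ∀ n : S, lev (.inr n) = 0 ∨ lev (.inr n) = 2 ∨ lev (.inr n) = 4 := by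
    intro n
    obtain ⟨p, -, q, -, -, hk⟩ := hf n
    change f n = 0 ∨ f n = 2 ∨ f n = 4
    omega
  have hne : ∀ u v, H.Adj u v → lev u ≠ lev v := by
    rintro (u | n) (v | m) huv
    · exact gridLevel_ne (G.adj_sub huv)
    · have := hgrid u; have := hnewlev m; omega
    · have := hgrid v; have := hnewlev n; omega
    · exact huv.elim
  refine wordRepresentable_of_semitransitive (lev := lev)
    (r := fun u v => H.Adj u v ∧ lev u < lev v) H ?_ (fun _ _ h => h.2) ?_
  · intro u v
    constructor
    · intro huv
      rcases (hne u v huv).lt_or_gt with hlt | hlt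
      · exact Or.inl ⟨huv, hlt⟩
      · exact Or.inr ⟨huv.symm, hlt⟩
    · rintro (h | h)
      · exact h.1
      · exact h.1.symm
  · intro x v y hxy hxv hvy
    refine semitransitive_of_levels (A := H.Adj) (fun _ _ h => h.symm) ?_ ?_ ?_ ?_ hxy.1 hxy.2
      hxv hvy
    · rintro (u | n)
      · have := hgrid u; omega
      · have := hnewlev n; omega
    · rintro (u | n) (v | m) huv h0
      · have := hgrid u; omega
      · have := hgrid u; omega
      · have := hgrid v; omega
      · exact huv.elim
    · rintro (u | n) p q h0 hpn hnq hpq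
      · have := hgrid u; omega
      · rcases p with p | p
        · rcases q with q | q
          · exact hS n n.2 p hpn q hnq fun he => hpq (congrArg gridLevel he)
          · exact hnq.elim
        · exact hpn.elim
    · rintro (u | n) p q t hk hnp hnq htp htq
      · have := hgrid u; omega
      · rcases p with p | p
        · rcases q with q | q
          · obtain ⟨p', hp', q', hq', hbd, hk'⟩ := hf n
            have hk : (f n = 0 ∧ gridLevel p = 1 ∧ gridLevel q = 5 ∨
              f n = 2 ∧ gridLevel p = 1 ∧ gridLevel q = 3 ∨
              f n = 4 ∧ gridLevel p = 3 ∧ gridLevel q = 5) := hk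
            obtain rfl : p' = p := Cell.eq_of_gridLevel_eq hp' hnp (by omega)
            obtain rfl : q' = q := Cell.eq_of_gridLevel_eq hq' hnq (by omega)
            rcases t with t | m
            · exact Or.inr (hbd.mem_of_adj (hS n n.2) hp' hq' htp htq)
            · left
              obtain ⟨hadj, d, hd, hpd, hqd⟩ := hbd
              have : (m : Cell) = n := Cell.eq_of_common_edge hadj.ne htp htq hp' hq' hpd hqd
                (fun he => hd (he ▸ hS m m.2)) (fun he => hd (he ▸ hS n n.2))
              rw [Subtype.ext this]
          · exact hnq.elim
        · exact hnp.elim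

end subdivision

/-! ### Interior cells -/

/-- Coordinates for the vertices of `A''` other than `1`: the vertices `2`, `3`, `4` form an upward
cell, and `5`, `6`, `0` are the remaining vertices of its neighbouring cells. The value at `1` is
immaterial. -/
def starCoords : Fin 7 → ℤ × ℤ := ![(-1, 1), (0, 0), (0, 0), (1, 0), (0, 1), (1, -1), (1, 1)]

/-- The points with coordinates `starCoords`, translated to `p`; for `ε = -1` they are reflected in
`p`, so that the central cell becomes a downward one. -/
def starPoint (p : ℤ × ℤ) (ε : ℤ) (i : Fin 7) : ℤ × ℤ :=
  (p.1 + ε * (starCoords i).1, p.2 + ε * (starCoords i).2)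

theorem starPoint_adj {p : ℤ × ℤ} {ε : ℤ} (hε : ε ^ 2 = 1) {i j : Fin 7} (hi : i ≠ 1) (hj : j ≠ 1)
    (h : triangularTiling.Adj (starPoint p ε i) (starPoint p ε j)) :
    graphADoublePrime.Adj i j := by
  rw [triangularTiling_adj] at h
  have h' : ((starCoords i).1 - (starCoords j).1) ^ 2 +
      ((starCoords i).1 - (starCoords j).1) * ((starCoords i).2 - (starCoords j).2) +
      ((starCoords i).2 - (starCoords j).2) ^ 2 = 1 := by
    simp only [starPoint] at h
    linear_combination h - (((starCoords i).1 - (starCoords j).1) ^ 2 +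
      ((starCoords i).1 - (starCoords j).1) * ((starCoords i).2 - (starCoords j).2) +
      ((starCoords i).2 - (starCoords j).2) ^ 2) * hε
  rw [graphADoublePrime_adj]
  clear h
  revert i j
  decide

theorem starPoint_injOn {p : ℤ × ℤ} {ε : ℤ} (hε : ε ^ 2 = 1) {i j : Fin 7} (hi : i ≠ 1)
    (hj : j ≠ 1) (h : starPoint p ε i = starPoint p ε j) : i = j := by
  have hε0 : ε ≠ 0 := by rintro rfl; simp at hε
  have h' : starCoords i = starCoords j := by
    simpa [starPoint, hε0, Prod.ext_iff] using h
  clear h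
  revert i j
  decide

/-- An interior cell `c` in `S` together with its neighbouring cells `d`, `d'`, `d''` yields an
induced `A''` in the subdivision. -/
theorem isIndContained_of_star {G : triangularTiling.Subgraph} {S : Set Cell} {c d d' d'' : Cell}
    {p : ℤ × ℤ} {ε : ℤ} (hε : ε ^ 2 = 1) (hcS : c ∈ S) (hint : IsInteriorCell G c)
    (hc : c.verts = {starPoint p ε 2, starPoint p ε 3, starPoint p ε 4})
    (hd : d.verts = {starPoint p ε 2, starPoint p ε 3, starPoint p ε 5})
    (hd' : d'.verts = {starPoint p ε 3, starPoint p ε 4, starPoint p ε 6})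
    (hd'' : d''.verts = {starPoint p ε 2, starPoint p ε 4, starPoint p ε 0}) :
    graphADoublePrime.IsIndContained (subdivision G S) := by
  -- A neighbouring cell of an interior cell belongs to the graph.
  have hbel : ∀ e : Cell, ∀ i j : Fin 7, i ≠ 1 → j ≠ 1 → i ≠ j →
      starPoint p ε i ∈ c.verts → starPoint p ε j ∈ c.verts → starPoint p ε i ∈ e.verts →
      starPoint p ε j ∈ e.verts → CellBelongs G e := by
    intro e i j hi hj hij hic hjc hie hje
    by_contra he
    exact hint.2 ⟨hint.1, _, hic, _, hjc,
      hint.1 _ hic _ hjc fun h => hij (starPoint_injOn hε hi hj h), e, he, hie, hje⟩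
  have hdb : CellBelongs G d := hbel d 2 3 (by decide) (by decide) (by decide)
    (by simp [hc]) (by simp [hc]) (by simp [hd]) (by simp [hd])
  have hdb' : CellBelongs G d' := hbel d' 3 4 (by decide) (by decide) (by decide)
    (by simp [hc]) (by simp [hc]) (by simp [hd']) (by simp [hd'])
  have hdb'' : CellBelongs G d'' := hbel d'' 2 4 (by decide) (by decide) (by decide)
    (by simp [hc]) (by simp [hc]) (by simp [hd'']) (by simp [hd''])
  have hadj : ∀ i j : Fin 7, i ≠ 1 → j ≠ 1 →
      (G.Adj (starPoint p ε i) (starPoint p ε j) ↔ graphADoublePrime.Adj i j) := by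
    intro i j hi hj
    refine ⟨fun h => starPoint_adj hε hi hj h.adj_sub, fun h => ?_⟩
    have hne : starPoint p ε i ≠ starPoint p ε j :=
      fun he => h.ne (starPoint_injOn hε hi hj he)
    have htri : ∀ i j : Fin 7, i ≠ 1 → j ≠ 1 → graphADoublePrime.Adj i j →
        ((i = 2 ∨ i = 3 ∨ i = 5) ∧ (j = 2 ∨ j = 3 ∨ j = 5)) ∨
        ((i = 3 ∨ i = 4 ∨ i = 6) ∧ (j = 3 ∨ j = 4 ∨ j = 6)) ∨
        ((i = 2 ∨ i = 4 ∨ i = 0) ∧ (j = 2 ∨ j = 4 ∨ j = 0)) := by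
      simp only [graphADoublePrime_adj]
      decide
    rcases htri i j hi hj h with ⟨hi, hj⟩ | ⟨hi, hj⟩ | ⟨hi, hj⟩
    · refine hdb _ ?_ _ ?_ hne
      · rcases hi with rfl | rfl | rfl <;> simp [hd]
      · rcases hj with rfl | rfl | rfl <;> simp [hd]
    · refine hdb' _ ?_ _ ?_ hne
      · rcases hi with rfl | rfl | rfl <;> simp [hd']
      · rcases hj with rfl | rfl | rfl <;> simp [hd']
    · refine hdb'' _ ?_ _ ?_ hne
      · rcases hi with rfl | rfl | rfl <;> simp [hd'']
      · rcases hj with rfl | rfl | rfl <;> simp [hd'']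
  have hmem : ∀ i : Fin 7, i ≠ 1 → starPoint p ε i ∈ G.verts := by
    intro i hi
    have hex : ∀ i : Fin 7, i ≠ 1 → ∃ j, j ≠ 1 ∧ graphADoublePrime.Adj i j := by
      simp only [graphADoublePrime_adj]
      decide
    obtain ⟨j, hj, hij⟩ := hex i hi
    exact ((hadj i j hi hj).2 hij).fst_mem
  have hcell : ∀ i : Fin 7, i ≠ 1 → (starPoint p ε i ∈ c.verts ↔ graphADoublePrime.Adj 1 i) := by
    intro i hi
    have hnb : ∀ i : Fin 7, graphADoublePrime.Adj 1 i ↔ i = 2 ∨ i = 3 ∨ i = 4 := by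
      simp only [graphADoublePrime_adj]
      decide
    rw [hnb, hc, Finset.mem_insert, Finset.mem_insert, Finset.mem_singleton]
    constructor
    · rintro (h | h | h)
      · exact Or.inl (starPoint_injOn hε hi (by decide) h)
      · exact Or.inr (Or.inl (starPoint_injOn hε hi (by decide) h))
      · exact Or.inr (Or.inr (starPoint_injOn hε hi (by decide) h))
    · rintro (rfl | rfl | rfl) <;> simp
  let e : Fin 7 → G.verts ⊕ S := fun i =>
    if hi : i = 1 then .inr ⟨c, hcS⟩ else .inl ⟨starPoint p ε i, hmem i hi⟩
  have he1 : e 1 = .inr ⟨c, hcS⟩ := dif_pos rfl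
  have he : ∀ i (hi : i ≠ 1), e i = .inl ⟨starPoint p ε i, hmem i hi⟩ := fun i hi => dif_neg hi
  refine ⟨⟨⟨e, fun i j hij => ?_⟩, fun {i j} => ?_⟩⟩
  · by_cases hi : i = 1 <;> by_cases hj : j = 1
    · rw [hi, hj]
    · rw [hi, he1, he j hj] at hij
      cases hij
    · rw [hj, he1, he i hi] at hij
      cases hij
    · rw [he i hi, he j hj] at hij
      exact starPoint_injOn hε hi hj (congrArg Subtype.val (Sum.inl_injective hij))
  · change subdivisionAdj G S (e i) (e j) ↔ _
    by_cases hi : i = 1 <;> by_cases hj : j = 1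
    · rw [hi, hj, he1]
      exact iff_of_false id (graphADoublePrime.loopless.irrefl 1)
    · rw [hi, he1, he j hj]
      exact hcell j hj
    · rw [hj, he1, he i hi, graphADoublePrime.adj_comm]
      exact hcell i hi
    · rw [he i hi, he j hj]
      exact hadj i j hi hj

theorem isIndContained_of_isInteriorCell {G : triangularTiling.Subgraph} {S : Set Cell} {c : Cell}
    (hc : c ∈ S) (hint : IsInteriorCell G c) :
    graphADoublePrime.IsIndContained (subdivision G S) := by
  cases c with
  | up x y =>
    refine isIndContained_of_star (p := (x, y)) (ε := 1) (d := .down x (y - 1)) (d' := .down x y)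
      (d'' := .down (x - 1) y) (by norm_num) hc hint ?_ ?_ ?_ ?_ <;>
    · ext ⟨s, t⟩
      simp [Cell.verts, starPoint, starCoords]
      try omega
  | down x y =>
    refine isIndContained_of_star (p := (x + 1, y + 1)) (ε := -1) (d := .up x (y + 1))
      (d' := .up x y) (d'' := .up (x + 1) y) (by norm_num) hc hint ?_ ?_ ?_ ?_ <;>
    · ext ⟨s, t⟩
      simp [Cell.verts, starPoint, starCoords]
      try omega

theorem mainTheorem1 (G : triangularTiling.Subgraph) (hG : IsTriangularGridGraph G)
    (S : Set Cell) (hS : ∀ c ∈ S, CellBelongs G c) :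
    (WordRepresentable (subdivision G S) ↔
      ¬ graphADoublePrime.IsIndContained (subdivision G S)) ∧
    (WordRepresentable (subdivision G S) ↔ ∀ c ∈ S, ¬ IsInteriorCell G c) := by
  have h1 : WordRepresentable (subdivision G S) →
      ¬ graphADoublePrime.IsIndContained (subdivision G S) :=
    fun h => h.not_isIndContained_graphADoublePrime
  have h2 : ¬ graphADoublePrime.IsIndContained (subdivision G S) →
      ∀ c ∈ S, ¬ IsInteriorCell G c :=
    fun h c hc hint => h (isIndContained_of_isInteriorCell hc hint)
  have h3 : (∀ c ∈ S, ¬ IsInteriorCell G c) → WordRepresentable (subdivision G S) := fun h =>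
    wordRepresentable_subdivision hG fun c hc => by_contra fun hb => h c hc ⟨hS c hc, hb⟩
  exact ⟨⟨h1, h3 ∘ h2⟩, ⟨h2 ∘ h1, h3⟩⟩
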